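/- Let $k$ be a perfect field. A variety over $k$ is a $k$-scheme of finite type; it is pure of dimension $n$ if each of its irreducible components has dimension $n$; a curve is a variety that is pure of dimension $1$ (not necessarily connected). Two varieties over $k$ are birational if a dense open subscheme of one is isomorphic over $k$ to a dense open subscheme of the other. (1) Let $Z$ be a geometrically reduced, separated variety over $k$ that is pure of dimension $n$, and suppose that $n>0$ or that $k$ is infinite. Then there is a non-zero polynomial $f\in k[x_1,\dots,x_{n+1}]$ such that the hypersurface $V=\operatorname{Spec} k[x_1,\dots,x_{n+1}]/(f)$ in $\mathbb{A}^{n+1}_k$ is smooth over $k$ and birational to $Z$. (2) Let $C$ be a smooth projective curve over $k$. Then $C$ has a dense affine open subscheme that is isomorphic over $k$ to a smooth plane curve $\operatorname{Spec} k[x,y]/(f)$ with $f\neq 0$. Moreover, $C$ is the smooth completion of a smooth curve $C_0=\operatorname{Spec} k[x^{\pm1},y^{\pm1}]/(g)$, $g\neq0$, in the torus $\mathbb{G}_{m,k}^2$; that is, $C$ is a smooth projective curve birational to $C_0$, and there is an open immersion $C_0\hookrightarrow C$ over $k$ with dense image. -/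

import Mathlib

open CategoryTheory AlgebraicGeometry

universe u

noncomputable section

/-- A topological space is pure of dimension `n` (equidimensional) if all its irreducible
components have dimension `n`. -/
def IsPureOfDim (X : Type*) [TopologicalSpace X] (n : ℕ) : Prop :=
  ∀ T ∈ irreducibleComponents X, topologicalKrullDim T = n

/-- The closed subscheme `f = 0` of the affine space `𝔸ᵐ` over `k`. -/
def affineHypersurface {k : Type u} [Field k] {m : ℕ} (f : MvPolynomial (Fin m) k) :
    Scheme.{u} :=
  Spec (.of (MvPolynomial (Fin m) k ⧸ Ideal.span {f}))

/-- The structure morphism of `f = 0` in `𝔸ᵐ` over `k`. -/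
def affineHypersurfaceToSpec {k : Type u} [Field k] {m : ℕ} (f : MvPolynomial (Fin m) k) :
    affineHypersurface f ⟶ Spec (.of k) :=
  Spec.map (CommRingCat.ofHom (algebraMap k (MvPolynomial (Fin m) k ⧸ Ideal.span {f})))

/-- The ring `k[x^{±1}, y^{±1}]` of Laurent polynomials in two variables, that is, `k[x, y]`
with `x y` inverted: the coordinate ring of the torus `𝔾ₘ²` over `k`. -/
abbrev TorusRing (k : Type u) [Field k] : Type u :=
  Localization.Away (MvPolynomial.X 0 * MvPolynomial.X 1 : MvPolynomial (Fin 2) k)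

/-- The closed subscheme `g = 0` of the torus `𝔾ₘ²` over `k`. -/
def torusCurve {k : Type u} [Field k] (g : TorusRing k) : Scheme.{u} :=
  Spec (.of (TorusRing k ⧸ Ideal.span {g}))

/-- The structure morphism of `g = 0` in `𝔾ₘ²` over `k`. -/
def torusCurveToSpec {k : Type u} [Field k] (g : TorusRing k) :
    torusCurve g ⟶ Spec (.of k) :=
  Spec.map (CommRingCat.ofHom (algebraMap k (TorusRing k ⧸ Ideal.span {g})))

section ProjectiveSpace

attribute [local instance] MvPolynomial.gradedAlgebra

/-- The projective space of dimension `m` over `k`, as `Proj k[x₀, …, xₘ]`. -/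
def projSpace (k : Type u) [Field k] (m : ℕ) : Scheme.{u} :=
  Proj (MvPolynomial.homogeneousSubmodule (Fin (m + 1)) k)

/-- The structure morphism of projective space over `k`. -/
def projSpaceToSpec (k : Type u) [Field k] (m : ℕ) : projSpace k m ⟶ Spec (.of k) :=
  Proj.toSpecZero (MvPolynomial.homogeneousSubmodule (Fin (m + 1)) k) ≫
    Spec.map (CommRingCat.ofHom
      (algebraMap k (MvPolynomial.homogeneousSubmodule (Fin (m + 1)) k 0)))

end ProjectiveSpace

/-- A `k`-scheme is projective if it is isomorphic to a closed subscheme of some `ℙᵐ`. -/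
def IsProjectiveOver {k : Type u} [Field k] {X : Scheme.{u}} (s : X ⟶ Spec (.of k)) : Prop :=
  ∃ (m : ℕ) (i : X ⟶ projSpace k m), IsClosedImmersion i ∧ i ≫ projSpaceToSpec k m = s

/-- A smooth projective curve over `k`: a smooth projective `k`-scheme, pure of dimension `1`,
not necessarily connected. -/
structure IsSmoothProjectiveCurve {k : Type u} [Field k] {C : Scheme.{u}}
    (s : C ⟶ Spec (.of k)) : Prop where
  smooth : Smooth s
  projective : IsProjectiveOver s
  pure : IsPureOfDim C 1

/-- `C` is the smooth completion of the smooth affine curve `U`: it is a smooth projective curve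
that is birational to `U` over `k`. -/
structure IsSmoothCompletion {k : Type u} [Field k] {C U : Scheme.{u}}
    (s : C ⟶ Spec (.of k)) (t : U ⟶ Spec (.of k)) : Prop where
  isSmoothProjectiveCurve : IsSmoothProjectiveCurve s
  birational : Scheme.BirationalOver t s

end

/-! A dense open of `Z` is a finite disjoint union of integral affine schemes, one per component,
inside a dense smooth open. Let `R` be the product of their coordinate rings, `L` its total ring of
fractions, `A = k[x₁,…,xₙ]` and `F = Frac A`. As `k` is perfect, `L` is a finite product of finite
separable extensions of `F`. As `F` is infinite, the factors have primitive elements with distinct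
minimal polynomials, so `L = F[X]/(g)` for a single `β` (`exists_generator_pi`), and `g` can be
given constant term `1` and coefficients in `A`. The constant term `1` does the work. It gives `A[β]
= A[X]/(g)`, a hypersurface in affine `(n+1)`-space, and makes `β` a unit of `A[β]`. Passing from
`β` to `β/h` replaces `g(X)` by `g(hX)`, keeps the constant term, and makes `h` a unit, since `h ·
(β/h) = β`. Thus for suitable `h` the ring `A[β/h]` contains any prescribed finite subset of `L`
(`exists_scale_subset`). Choosing that set well makes `A[β/h]` a localization `R[1/r]`
(`exists_hypersurface_of_isNormalizedGenerator`). The hypersurface is then a dense open subscheme of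
`Spec R`, so it inherits smoothness. Putting the `1/xᵢ` in the set makes all coordinates units,
which places the curve in the torus. -/

/-! ### Krull dimension and transcendence degree -/

section Dimension

/-- Incomparability bounds chains upstairs; lying over and going up lift chains from downstairs. -/
theorem ringKrullDim_eq_of_isIntegral_of_injective (R S : Type*) [CommRing R] [CommRing S]
    [Algebra R S] [Algebra.IsIntegral R S] [FaithfulSMul R S] :
    ringKrullDim S = ringKrullDim R := by
  apply le_antisymm
  · refine Order.krullDim_le_of_strictMono (PrimeSpectrum.comap (algebraMap R S)) fun p q h ↦ ?_
    exact Ideal.IsIntegral.comap_lt_comap h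
  · refine iSup_le fun l ↦ ?_
    obtain ⟨P, hP⟩ := Algebra.IsIntegral.comap_surjective R S l.head
    have : P.asIdeal.LiesOver l.head.asIdeal := ⟨by rw [← hP]; rfl⟩
    obtain ⟨L, hL, -⟩ := Ideal.exists_ltSeries_of_hasGoingUp l P.asIdeal
    rw [← hL]
    exact le_iSup (fun p : LTSeries (PrimeSpectrum S) ↦ ((p.length : ℕ∞) : WithBot ℕ∞)) L

open Algebra in
theorem trdeg_eq_of_isAlgebraic (k : Type*) {A B : Type u} [Field k] [CommRing A] [CommRing B]
    [IsDomain B] [Algebra k A] [Algebra k B] [Algebra A B] [IsScalarTower k A B]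
    [FaithfulSMul A B] [Algebra.IsAlgebraic A B] : Algebra.trdeg k B = Algebra.trdeg k A := by
  have : IsDomain A := (FaithfulSMul.algebraMap_injective A B).isDomain
  have := (FaithfulSMul.algebraMap_injective A B).nontrivial
  have : Nontrivial A := inferInstance
  have : FaithfulSMul k A := inferInstance
  rw [← trdeg_add_eq k A, trdeg_eq_zero (R := A), add_zero]

theorem ringKrullDim_eq_trdeg (k A : Type u) [Field k] [CommRing A] [IsDomain A] [Algebra k A]
    [Algebra.FiniteType k A] :
    ringKrullDim A = ((Cardinal.toNat (Algebra.trdeg k A) : ℕ∞) : WithBot ℕ∞) := by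
  obtain ⟨s, g, hg, hfin⟩ := exists_finite_inj_algHom_of_fg k A
  algebraize [g.toRingHom]
  have : IsScalarTower k (MvPolynomial (Fin s) k) A :=
    IsScalarTower.of_algebraMap_eq' g.comp_algebraMap.symm
  have : FaithfulSMul (MvPolynomial (Fin s) k) A :=
    (faithfulSMul_iff_algebraMap_injective _ _).mpr hg
  have : Module.Finite (MvPolynomial (Fin s) k) A := hfin
  rw [ringKrullDim_eq_of_isIntegral_of_injective (MvPolynomial (Fin s) k) A,
    MvPolynomial.ringKrullDim_of_isNoetherianRing, trdeg_eq_of_isAlgebraic k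
      (A := MvPolynomial (Fin s) k),
    MvPolynomial.trdeg_of_isDomain]
  simp [ringKrullDim_eq_zero_of_field]

/-- Both sides are transcendence degrees over `k`. Finite type is essential: inverting a uniformizer
of a discrete valuation ring lowers the dimension. -/
theorem ringKrullDim_localization_away (k : Type u) {A B : Type u} [Field k] [CommRing A]
    [IsDomain A] [CommRing B] [Algebra k A] [Algebra.FiniteType k A] [Algebra A B]
    {a : A} (ha : a ≠ 0) [IsLocalization.Away a B] : ringKrullDim B = ringKrullDim A := by
  algebraize [(algebraMap A B).comp (algebraMap k A)]
  have hM : Submonoid.powers a ≤ nonZeroDivisors A := powers_le_nonZeroDivisors_of_noZeroDivisors ha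
  have : IsDomain B := IsLocalization.isDomain_of_le_nonZeroDivisors B hM
  have : FaithfulSMul A B := (faithfulSMul_iff_algebraMap_injective _ _).mpr
    (IsLocalization.injective B hM)
  have : Algebra.FiniteType A B := IsLocalization.finiteType_of_monoid_fg (Submonoid.powers a) B
  have : Algebra.FiniteType k B := .trans (S := A) inferInstance inferInstance
  have : Algebra.IsAlgebraic A B := IsLocalization.isAlgebraic B (Submonoid.powers a)
  rw [ringKrullDim_eq_trdeg k A, ringKrullDim_eq_trdeg k B, trdeg_eq_of_isAlgebraic k (A := A)]

end Dimension

/-! ### Separating transcendence bases -/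

theorem exists_algHom_rationalFunctions_isSeparable (k : Type u) [Field k] [PerfectField k]
    (A : Type u) [CommRing A] [IsDomain A] [Algebra k A] [Algebra.FiniteType k A] (n : ℕ)
    (hn : ringKrullDim A = n) (K : Type u) [Field K] [Algebra A K] [Algebra k K]
    [IsScalarTower k A K] [IsFractionRing A K] :
    ∃ φ : FractionRing (MvPolynomial (Fin n) k) →ₐ[k] K,
      let := φ.toRingHom.toAlgebra
      FiniteDimensional (FractionRing (MvPolynomial (Fin n) k)) K ∧
        Algebra.IsSeparable (FractionRing (MvPolynomial (Fin n) k)) K := by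
  have : Algebra.EssFiniteType A K := .of_isLocalization _ (nonZeroDivisors A)
  have : Algebra.EssFiniteType k K := .comp k A K
  obtain ⟨s, hs, hsep⟩ := exists_isTranscendenceBasis_and_isSeparable_of_perfectField k K
  have : Algebra.IsAlgebraic A K := IsLocalization.isAlgebraic K (nonZeroDivisors A)
  have : FaithfulSMul A K := inferInstance
  have hcard : n = s.card := by
    have h1 := hs.cardinalMk_eq_trdeg
    rw [trdeg_eq_of_isAlgebraic k (A := A)] at h1
    rw [ringKrullDim_eq_trdeg k A, ← h1] at hn
    simpa using hn.symm
  subst hcard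
  let e : Fin s.card ≃ s := s.equivFin.symm
  have hx : IsTranscendenceBasis k (fun i ↦ (e i : K)) := hs.comp_equiv e
  have hinj : Function.Injective (MvPolynomial.aeval (R := k) fun i ↦ (e i : K)) := hx.1
  let φ : FractionRing (MvPolynomial (Fin s.card) k) →ₐ[k] K := IsFractionRing.liftAlgHom hinj
  refine ⟨φ, ?_⟩
  let := φ.toRingHom.toAlgebra
  have : IsScalarTower k (FractionRing (MvPolynomial (Fin s.card) k)) K :=
    IsScalarTower.of_algebraMap_eq' φ.comp_algebraMap.symm
  -- Separability is known over `k(s)`; it passes up to the image of `φ`, then along the isomorphism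
  -- of the source with that image.
  have hr : IntermediateField.adjoin k (s : Set K) ≤ φ.fieldRange := by
    rw [IntermediateField.adjoin_le_iff]
    intro y hy
    refine ⟨algebraMap (MvPolynomial (Fin s.card) k) _ (MvPolynomial.X (e.symm ⟨y, hy⟩)), ?_⟩
    simp [φ, IsFractionRing.liftAlgHom_apply]
  have hsep' : Algebra.IsSeparable (FractionRing (MvPolynomial (Fin s.card) k)) K := by
    let := (IntermediateField.inclusion hr).toRingHom.toAlgebra
    have : IsScalarTower (IntermediateField.adjoin k (s : Set K)) φ.fieldRange K :=
      IsScalarTower.of_algebraMap_eq fun _ ↦ rfl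
    have := Algebra.isSeparable_tower_top_of_isSeparable
      (IntermediateField.adjoin k (s : Set K)) φ.fieldRange K
    let e' : FractionRing (MvPolynomial (Fin s.card) k) ≃+* φ.fieldRange :=
      RingEquiv.ofBijective (φ.toRingHom.codRestrict φ.fieldRange fun x ↦ ⟨x, rfl⟩)
        ⟨RingHom.injective _, fun ⟨y, x, hx⟩ ↦ ⟨x, Subtype.ext hx⟩⟩
    refine Algebra.IsSeparable.of_equiv_equiv e'.symm (RingEquiv.refl K) (RingHom.ext fun x ↦ ?_)
    obtain ⟨x, rfl⟩ := e'.surjective x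
    simp
    rfl
  have : Algebra.EssFiniteType (FractionRing (MvPolynomial (Fin s.card) k)) K := .of_comp k _ _
  exact ⟨Algebra.finite_of_essFiniteType_of_isAlgebraic, hsep'⟩

/-! ### A single generator for a product of separable extensions -/

section Generator

open Polynomial

/-- The translates `α + c` of a primitive element are primitive, and a given polynomial has only
finitely many of them as roots. -/
theorem infinite_minpoly_of_primitive (F K : Type*) [Field F] [Infinite F] [Field K] [Algebra F K]
    [FiniteDimensional F K] [Algebra.IsSeparable F K] :
    {m : F[X] | ∃ α : K, minpoly F α = m ∧ Function.Surjective (aeval (R := F) α)}.Infinite := by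
  obtain ⟨α, hα⟩ := Field.exists_primitive_element F K
  have hα' : Algebra.adjoin F {α} = ⊤ := by
    rw [← IntermediateField.adjoin_simple_toSubalgebra_of_isAlgebraic
      (Algebra.IsAlgebraic.isAlgebraic α), hα]
    rfl
  rw [Algebra.adjoin_singleton_eq_range_aeval] at hα'
  have hsurj (c : F) : Function.Surjective (aeval (R := F) (α + algebraMap F K c)) := by
    intro y
    obtain ⟨p, rfl⟩ : y ∈ (aeval (R := F) α).range := hα' ▸ Algebra.mem_top
    exact ⟨p.comp (X - C c), by simp [aeval_comp]⟩
  refine Set.Infinite.mono (s := Set.range fun c : F ↦ minpoly F (α + algebraMap F K c)) ?_ ?_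
  · rintro _ ⟨c, rfl⟩
    exact ⟨_, rfl, hsurj c⟩
  · intro hfin
    have := hfin.to_subtype
    obtain ⟨m, hm⟩ := Finite.exists_infinite_fiber
      (Set.rangeFactorization fun c : F ↦ minpoly F (α + algebraMap F K c))
    obtain ⟨m, c₀, rfl⟩ := m
    refine hm.not_finite (Set.Finite.subset (Set.Finite.preimage
      (f := fun c : F ↦ α + algebraMap F K c) (fun x _ y _ h ↦ ?_)
      (Polynomial.finite_setOfPred_isRoot (Polynomial.map_ne_zero (f := algebraMap F K)
      (minpoly.ne_zero (Algebra.IsIntegral.isIntegral (α + algebraMap F K c₀)))))) ?_)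
    · simpa using h
    · intro c hc
      have : minpoly F (α + algebraMap F K c) = minpoly F (α + algebraMap F K c₀) :=
        congrArg Subtype.val hc
      simp [← this, IsRoot, eval_map_algebraMap]

/-- Hall's marriage theorem for subsets of size `|ι|`, where the marriage condition is automatic. -/
theorem exists_injective_choice {ι X : Type*} [Finite ι] (S : ι → Set X)
    (hS : ∀ i, (S i).Infinite) : ∃ f : ι → X, Function.Injective f ∧ ∀ i, f i ∈ S i := by
  classical
  have := Fintype.ofFinite ι
  choose t ht hc using fun i ↦ (hS i).exists_subset_card_eq (Fintype.card ι)
  obtain ⟨f, hf, hft⟩ := (Finset.all_card_le_biUnion_card_iff_exists_injective t).mp fun s ↦ by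
    obtain rfl | ⟨i, hi⟩ := s.eq_empty_or_nonempty
    · simp
    · exact s.card_le_univ.trans ((hc i).symm.le.trans
        (Finset.card_le_card (Finset.subset_biUnion_of_mem t hi)))
  exact ⟨f, hf, fun i ↦ ht i (hft i)⟩

/-- Distinct monic irreducible polynomials are coprime, so the Chinese remainder theorem applies to
the minimal polynomials of the components of `β`. -/
theorem exists_generator_pi {F ι : Type*} [Field F] [Infinite F] [Finite ι] (K : ι → Type*)
    [∀ i, Field (K i)] [∀ i, Algebra F (K i)] [∀ i, FiniteDimensional F (K i)]
    [∀ i, Algebra.IsSeparable F (K i)] :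
    ∃ (β : Π i, K i) (g : F[X]), g.coeff 0 = 1 ∧ Function.Surjective (aeval (R := F) β) ∧
      ∀ p : F[X], aeval β p = 0 ↔ g ∣ p := by
  have := Fintype.ofFinite ι
  -- Excluding `X` keeps every component of `β` nonzero, so the product of the minimal polynomials
  -- can be normalized to constant term `1`.
  obtain ⟨m, hm, hmem⟩ := exists_injective_choice
    (fun i ↦ {m : F[X] | ∃ α : K i, minpoly F α = m ∧ Function.Surjective (aeval (R := F) α)} \ {X})
    fun i ↦ (infinite_minpoly_of_primitive F (K i)).sdiff (Set.finite_singleton X)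
  choose β hβ hsurj using fun i ↦ (hmem i).1
  have hX (i) : m i ≠ X := (hmem i).2
  have hint (i) : IsIntegral F (β i) := Algebra.IsIntegral.isIntegral _
  have hcop : Pairwise (Function.onFun IsCoprime m) := fun i j hij ↦ by
    refine ((hβ i ▸ minpoly.irreducible (hint i) : Irreducible (m i))).coprime_iff_not_dvd.mpr
      fun h ↦ ?_
    refine hm.ne hij (eq_of_monic_of_associated (hβ i ▸ minpoly.monic (hint i))
      (hβ j ▸ minpoly.monic (hint j)) ?_)
    exact (hβ i ▸ minpoly.irreducible (hint i) : Irreducible (m i)).associated_of_dvd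
      (hβ j ▸ minpoly.irreducible (hint j)) h
  have haeval (p : F[X]) (i : ι) : aeval β p i = aeval (β i) p :=
    (aeval_algHom_apply (Pi.evalAlgHom F K i) β p).symm
  have h0 (i) : (m i).coeff 0 ≠ 0 := fun h ↦ by
    rw [← hβ, minpoly.coeff_zero_eq_zero (hint i)] at h
    have := hβ i
    rw [h, minpoly.zero] at this
    exact hX i this.symm
  have hprod : (∏ i, (m i).coeff 0) ≠ 0 := Finset.prod_ne_zero_iff.mpr fun i _ ↦ h0 i
  refine ⟨β, C (∏ i, (m i).coeff 0)⁻¹ * ∏ i, m i, ?_, ?_, ?_⟩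
  · simp [coeff_zero_prod, hprod]
  · intro y
    choose p hp using fun i ↦ hsurj i (y i)
    obtain ⟨q, hq⟩ := Ideal.exists_forall_sub_mem_ideal
      (I := fun i ↦ Ideal.span {m i})
      (fun i j hij ↦ (Ideal.isCoprime_span_singleton_iff _ _).mpr (hcop hij)) p
    refine ⟨q, funext fun i ↦ ?_⟩
    have := hq i
    rw [Ideal.mem_span_singleton, ← hβ, minpoly.dvd_iff, map_sub, sub_eq_zero] at this
    rw [haeval, this, hp]
  · intro p
    rw [(isUnit_C.mpr (isUnit_iff_ne_zero.mpr (inv_ne_zero hprod))).mul_left_dvd, funext_iff]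
    simp only [haeval, Pi.zero_apply, ← minpoly.dvd_iff, hβ]
    exact ⟨fun h ↦ Finset.prod_dvd_of_coprime (fun i _ j _ hij ↦ hcop hij) fun i _ ↦ h i,
      fun h i ↦ (Finset.dvd_prod_of_mem m (Finset.mem_univ i)).trans h⟩

end Generator

/-! ### Normalized generators and their rescaling -/

section Scaling

open Polynomial

/-- With constant term `1`, `g` is invertible as a power series, so the coefficients of the quotient
are determined from the lowest degree up without division. This replaces Gauss's lemma. -/
theorem Polynomial.dvd_of_map_dvd_of_coeff_zero {A F : Type*} [CommRing A] [CommRing F]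
    {φ : A →+* F} (hφ : Function.Injective φ) {g p : A[X]} (hg : g.coeff 0 = 1)
    (h : g.map φ ∣ p.map φ) : g ∣ p := by
  obtain ⟨q, hq⟩ := h
  have key : ∀ n, ∃ a, φ a = q.coeff n := by
    intro n
    induction n using Nat.strong_induction_on with
    | _ n ih =>
      have h1 := congrArg (coeff · n) hq
      simp only [coeff_map, coeff_mul] at h1
      rw [Finset.Nat.sum_antidiagonal_eq_sum_range_succ_mk, Finset.sum_range_succ'] at h1
      simp only [hg, map_one, one_mul, Nat.sub_zero] at h1
      have h2 : ∃ a, φ a = ∑ i ∈ Finset.range n, φ (g.coeff (i + 1)) * q.coeff (n - (i + 1)) := by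
        rw [← RingHom.mem_range]
        refine sum_mem fun i hi ↦ mul_mem ⟨_, rfl⟩ (ih _ ?_)
        have := Finset.mem_range.mp hi
        omega
      obtain ⟨a, ha⟩ := h2
      exact ⟨p.coeff n - a, by rw [map_sub, h1, ha]; ring⟩
  obtain ⟨q', rfl⟩ : q ∈ lifts φ := (lifts_iff_coeff_lifts q).mpr key
  exact ⟨q', Polynomial.map_injective φ hφ (by rw [hq, Polynomial.map_mul]; rfl)⟩

variable {A F L : Type*} [CommRing A] [IsDomain A] [Field F] [Algebra A F] [IsFractionRing A F]
  [CommRing L] [Algebra A L] [Algebra F L] [IsScalarTower A F L]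

set_option linter.unusedSectionVars false

/-- `β` generates the `F`-algebra `L`, with relations the multiples of `g`, a polynomial over
`A` with constant coefficient `1`. -/
structure IsNormalizedGenerator (F : Type*) [Field F] [Algebra A F] [Algebra F L]
    (β : L) (g : A[X]) : Prop where
  coeff_zero : g.coeff 0 = 1
  surjective : Function.Surjective (aeval (R := F) β)
  aeval_eq_zero_iff (p : F[X]) : aeval β p = 0 ↔ g.map (algebraMap A F) ∣ p

theorem comp_C_mul_X_dvd_iff {h : F} (hh : h ≠ 0) (p q : F[X]) :
    p.comp (C h * X) ∣ q ↔ p ∣ q.comp (C h⁻¹ * X) := by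
  have h1 (p : F[X]) : (p.comp (C h * X)).comp (C h⁻¹ * X) = p := by
    rw [comp_assoc]; simp [← mul_assoc, ← C_mul, hh]
  have h2 (p : F[X]) : (p.comp (C h⁻¹ * X)).comp (C h * X) = p := by
    rw [comp_assoc]; simp [← mul_assoc, ← C_mul, hh]
  constructor
  · rintro ⟨r, rfl⟩
    rw [mul_comp, h1]
    exact dvd_mul_right _ _
  · rintro ⟨r, hr⟩
    rw [← h2 q, hr, mul_comp]
    exact dvd_mul_right _ _

/-- For a common denominator `e` of the coefficients, `β/e` has relation `g(eX)`: the degree `n`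
coefficient gains `eⁿ`, which clears it for `n ≥ 1`, and the constant term stays `1`. -/
theorem exists_isNormalizedGenerator {β : L} {g : F[X]} (h0 : g.coeff 0 = 1)
    (hsurj : Function.Surjective (aeval (R := F) β))
    (hker : ∀ p : F[X], aeval β p = 0 ↔ g ∣ p) :
    ∃ (β' : L) (g' : A[X]), IsNormalizedGenerator F β' g' := by
  classical
  obtain ⟨⟨e, he⟩, hint⟩ := IsLocalization.exist_integer_multiples_of_finset (nonZeroDivisors A)
    (g.support.image g.coeff)
  have he0 : algebraMap A F e ≠ 0 := IsFractionRing.to_map_ne_zero_of_mem_nonZeroDivisors he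
  have hl : g.comp (C (algebraMap A F e) * X) ∈ lifts (algebraMap A F) := by
    rw [lifts_iff_coeff_lifts]
    intro n
    rw [comp_C_mul_X_coeff]
    obtain rfl | n := n
    · exact ⟨1, by simp [h0]⟩
    by_cases hn : g.coeff (n + 1) = 0
    · exact ⟨0, by simp [hn]⟩
    obtain ⟨a, ha⟩ := hint _ (Finset.mem_image_of_mem g.coeff (mem_support_iff.mpr hn))
    refine ⟨a * e ^ n, ?_⟩
    simp only [map_mul, map_pow, ha, Algebra.smul_def]
    ring
  obtain ⟨g', hg'⟩ := hl
  replace hg' : g'.map (algebraMap A F) = _ := hg'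
  have hcomp (p : F[X]) : aeval ((algebraMap A F e)⁻¹ • β) p =
      aeval β (p.comp (C (algebraMap A F e)⁻¹ * X)) := by
    rw [aeval_comp]; simp [Algebra.smul_def]
  refine ⟨(algebraMap A F e)⁻¹ • β, g', ?_, ?_, ?_⟩
  · apply IsFractionRing.injective A F
    rw [← coeff_map, hg', comp_C_mul_X_coeff]
    simp [h0]
  · intro y
    obtain ⟨p, rfl⟩ := hsurj y
    refine ⟨p.comp (C (algebraMap A F e) * X), ?_⟩
    rw [hcomp, comp_assoc]
    simp [← mul_assoc, ← C_mul, he0]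
  · intro p
    rw [hcomp, hker, hg', comp_C_mul_X_dvd_iff he0]

theorem mem_adjoin_inv_smul {h : A} (hh : algebraMap A F h ≠ 0) (β : L) :
    β ∈ Algebra.adjoin A {(algebraMap A F h)⁻¹ • β} := by
  have : algebraMap A L h * ((algebraMap A F h)⁻¹ • β) = β := by
    rw [IsScalarTower.algebraMap_apply A F L, ← Algebra.smul_def, smul_smul,
      mul_inv_cancel₀ hh, one_smul]
  have h2 := mul_mem (Subalgebra.algebraMap_mem (Algebra.adjoin A {(algebraMap A F h)⁻¹ • β}) h)
    (Algebra.self_mem_adjoin_singleton A ((algebraMap A F h)⁻¹ • β))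
  rwa [this] at h2

theorem adjoin_le_adjoin_inv_smul {h : A} (hh : algebraMap A F h ≠ 0) (β : L) :
    Algebra.adjoin A {β} ≤ Algebra.adjoin A {(algebraMap A F h)⁻¹ • β} :=
  Algebra.adjoin_le (Set.singleton_subset_iff.mpr (mem_adjoin_inv_smul hh β))

namespace IsNormalizedGenerator

variable {β : L} {g : A[X]}

theorem scale (H : IsNormalizedGenerator F β g) {h : A} (hh : h ≠ 0) :
    IsNormalizedGenerator F ((algebraMap A F h)⁻¹ • β) (g.comp (C h * X)) := by
  have hh' : algebraMap A F h ≠ 0 := by simpa using hh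
  have hcomp (p : F[X]) : aeval ((algebraMap A F h)⁻¹ • β) p =
      aeval β (p.comp (C (algebraMap A F h)⁻¹ * X)) := by
    rw [aeval_comp]; simp [Algebra.smul_def]
  refine ⟨?_, ?_, ?_⟩
  · simp [comp_C_mul_X_coeff, H.coeff_zero]
  · intro y
    obtain ⟨p, rfl⟩ := H.surjective y
    refine ⟨p.comp (C (algebraMap A F h) * X), ?_⟩
    rw [hcomp, comp_assoc]
    simp [← mul_assoc, ← C_mul, hh']
  · intro p
    rw [hcomp, H.aeval_eq_zero_iff, Polynomial.map_comp]
    simp only [Polynomial.map_mul, map_C, map_X]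
    rw [comp_C_mul_X_dvd_iff hh']

theorem aeval_eq_zero_iff_dvd (H : IsNormalizedGenerator F β g) (p : A[X]) :
    aeval β p = 0 ↔ g ∣ p := by
  rw [← aeval_map_algebraMap F, H.aeval_eq_zero_iff]
  exact ⟨dvd_of_map_dvd_of_coeff_zero (IsFractionRing.injective A F) H.coeff_zero,
    fun h ↦ Polynomial.map_dvd _ h⟩

/-- Write `g = X · q + 1` and evaluate at `β`: the inverse is `-q(β)`. -/
theorem exists_mul_eq_one (H : IsNormalizedGenerator F β g) :
    ∃ c ∈ Algebra.adjoin A {β}, β * c = 1 := by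
  have h := (H.aeval_eq_zero_iff_dvd g).mpr dvd_rfl
  rw [← divX_mul_X_add g, H.coeff_zero] at h
  refine ⟨- aeval β g.divX, neg_mem (aeval_mem_adjoin_singleton A β), ?_⟩
  simp only [map_add, map_mul, aeval_X, map_one] at h
  linear_combination -h

/-- `h` divides `β = h · (β/h)`, which is already a unit in the smaller ring `A[β]`. -/
theorem exists_scale_mul_eq_one (H : IsNormalizedGenerator F β g) {h : A} (hh : h ≠ 0) :
    ∃ c ∈ Algebra.adjoin A {(algebraMap A F h)⁻¹ • β}, algebraMap A L h * c = 1 := by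
  have hh' : algebraMap A F h ≠ 0 := by simpa using hh
  obtain ⟨c, hc, hc1⟩ := H.exists_mul_eq_one
  have hm := Algebra.self_mem_adjoin_singleton A ((algebraMap A F h)⁻¹ • β)
  refine ⟨((algebraMap A F h)⁻¹ • β) * c, mul_mem hm (adjoin_le_adjoin_inv_smul hh' β hc), ?_⟩
  rw [← mul_assoc, IsScalarTower.algebraMap_apply A F L, ← Algebra.smul_def, smul_smul,
    mul_inv_cancel₀ hh', one_smul, hc1]

/-- Each element of `L` has a denominator in `A` relative to `A[β]`. With `h` the product of these
denominators, `h` and hence each of its factors become invertible in `A[β/h]`. -/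
theorem exists_scale_subset (H : IsNormalizedGenerator F β g) (s : Finset L) :
    ∃ h : A, h ≠ 0 ∧ (s : Set L) ⊆ Algebra.adjoin A {(algebraMap A F h)⁻¹ • β} := by
  have h1 (ℓ : L) : ∃ d : A, d ≠ 0 ∧ algebraMap A L d * ℓ ∈ Algebra.adjoin A {β} := by
    obtain ⟨p, rfl⟩ := H.surjective ℓ
    obtain ⟨d, hd0, hd⟩ := IsLocalization.integerNormalization_spec (nonZeroDivisors A) p
    refine ⟨d, nonZeroDivisors.ne_zero hd0, ?_⟩
    rw [← Algebra.smul_def, ← algebraMap_smul F d, ← map_smul, algebraMap_smul, ← hd,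
      aeval_map_algebraMap]
    exact aeval_mem_adjoin_singleton A β
  choose d hd0 hd using h1
  have hne : ∏ ℓ ∈ s, d ℓ ≠ 0 := Finset.prod_ne_zero_iff.mpr fun ℓ _ ↦ hd0 ℓ
  refine ⟨∏ ℓ ∈ s, d ℓ, hne, fun ℓ hℓ ↦ ?_⟩
  obtain ⟨c, hc, hc1⟩ := H.exists_scale_mul_eq_one hne
  set h := ∏ ℓ ∈ s, d ℓ with hdef
  have hle := adjoin_le_adjoin_inv_smul (L := L) (F := F) (h := h) (by simpa using hne) β
  obtain ⟨e, he⟩ := Finset.dvd_prod_of_mem d hℓ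
  have : ℓ = c * (algebraMap A L e * (algebraMap A L (d ℓ) * ℓ)) := by
    rw [← hdef] at he
    rw [he, map_mul] at hc1
    linear_combination (-ℓ) * hc1
  rw [this]
  exact mul_mem hc (mul_mem (Subalgebra.algebraMap_mem _ e) (hle (hd ℓ)))

end IsNormalizedGenerator

end Scaling

/-! ### The hypersurface ring as a localization -/

section Hypersurface

/-- The subalgebra of the elements of `L` that can be written as `a / r ^ m` with `a ∈ R`. -/
def awaySubalgebra (k : Type*) {R : Type*} (L : Type*) [CommSemiring k] [CommRing R] [CommRing L]
    [Algebra k R] [Algebra k L] [Algebra R L] [IsScalarTower k R L] (r : R) : Subalgebra k L where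
  carrier := {x | ∃ (m : ℕ) (a : R), algebraMap R L a = algebraMap R L r ^ m * x}
  mul_mem' := by
    rintro x y ⟨m, a, ha⟩ ⟨l, b, hb⟩
    exact ⟨m + l, a * b, by rw [map_mul, ha, hb]; ring⟩
  add_mem' := by
    rintro x y ⟨m, a, ha⟩ ⟨l, b, hb⟩
    exact ⟨m + l, r ^ l * a + r ^ m * b, by simp only [map_add, map_mul, map_pow, ha, hb]; ring⟩
  algebraMap_mem' c := ⟨0, algebraMap k R c, by simp [← IsScalarTower.algebraMap_apply]⟩

theorem algebraMap_mem_of_forall_X_mem {k σ L : Type*} [CommRing k] [CommRing L]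
    [Algebra k L] [Algebra (MvPolynomial σ k) L] [IsScalarTower k (MvPolynomial σ k) L]
    {D : Subalgebra k L} (hD : ∀ i, algebraMap (MvPolynomial σ k) L (.X i) ∈ D)
    (a : MvPolynomial σ k) : algebraMap (MvPolynomial σ k) L a ∈ D := by
  induction a using MvPolynomial.induction_on with
  | C c =>
    rw [← MvPolynomial.algebraMap_eq, ← IsScalarTower.algebraMap_apply]
    exact D.algebraMap_mem c
  | add p q hp hq => rw [map_add]; exact add_mem hp hq
  | mul_X p i hp => rw [map_mul]; exact mul_mem hp (hD i)

/-- Inside `L`, the ring `Q` lies between `R` and `R[1/r]`, and `r` is invertible in it. -/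
theorem isLocalization_away_of_injective {k R Q L : Type*} [CommRing k] [CommRing R] [CommRing Q]
    [CommRing L] [Algebra k R] [Algebra k Q] [Algebra k L] [Algebra R L] [IsScalarTower k R L]
    (Ψ : Q →ₐ[k] L) (hΨ : Function.Injective Ψ) (hRL : Function.Injective (algebraMap R L))
    [Algebra R Q] (hφ : ∀ a, Ψ (algebraMap R Q a) = algebraMap R L a)
    (r : R) (hr : IsUnit (algebraMap R Q r)) (hQ : ∀ q, Ψ q ∈ awaySubalgebra k L r) :
    IsLocalization.Away r Q where
  map_units := by
    rintro ⟨_, m, rfl⟩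
    simpa using hr.pow m
  surj q := by
    obtain ⟨m, a, h⟩ := hQ q
    refine ⟨⟨a, ⟨r ^ m, m, rfl⟩⟩, hΨ ?_⟩
    rw [map_mul, hφ, hφ, h, map_pow, mul_comm]
  exists_of_eq {a b} h := ⟨1, by
    have := congrArg Ψ h
    rw [hφ, hφ] at this
    rw [hRL this]⟩

-- Two inclusions in `L` are balanced. The choice of `h` forces `R[1/r] ⊆ A[β/h]`; conversely the
-- generators `xᵢ` and `β/h` lie in `R[1/r]`, because `σ` is a common denominator of `β` and the
-- `xᵢ`, and `r` is `σ` times a numerator of `h`.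
open Polynomial in
theorem exists_hypersurface_of_isNormalizedGenerator {k R L : Type*} [Field k] (n : ℕ)
    [CommRing R] [CommRing L] [Algebra k R] [Algebra k L] [Algebra R L] [IsScalarTower k R L]
    [Algebra.FiniteType k R] [IsFractionRing R L]
    [Algebra (MvPolynomial (Fin n) k) L] [Algebra (FractionRing (MvPolynomial (Fin n) k)) L]
    [IsScalarTower k (MvPolynomial (Fin n) k) L]
    [IsScalarTower (MvPolynomial (Fin n) k) (FractionRing (MvPolynomial (Fin n) k)) L]
    {β : L} {g : (MvPolynomial (Fin n) k)[X]}
    (H : IsNormalizedGenerator (FractionRing (MvPolynomial (Fin n) k)) β g) :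
    ∃ f : MvPolynomial (Fin (n + 1)) k, f ≠ 0 ∧
      (∀ i, IsUnit (Ideal.Quotient.mk (Ideal.span {f}) (.X i))) ∧
      ∃ (φ : R →ₐ[k] MvPolynomial (Fin (n + 1)) k ⧸ Ideal.span {f}) (r : R),
        Function.Injective φ ∧ @IsLocalization.Away _ _ r _ _ φ.toRingHom.toAlgebra := by
  classical
  let A := MvPolynomial (Fin n) k
  let F := FractionRing A
  have hRL : Function.Injective (algebraMap R L) := IsFractionRing.injective R L
  -- a common denominator
  obtain ⟨σ, hσ⟩ := IsLocalization.exist_integer_multiples_of_finset (nonZeroDivisors R)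
    (insert β (Finset.univ.image fun i ↦ algebraMap A L (.X i)))
  have hσβ : β ∈ awaySubalgebra k L (σ : R) := by
    obtain ⟨a, ha⟩ := hσ β (Finset.mem_insert_self _ _)
    exact ⟨1, a, by rw [ha, Algebra.smul_def, pow_one]⟩
  have hσX (i) : algebraMap A L (.X i) ∈ awaySubalgebra k L (σ : R) := by
    obtain ⟨a, ha⟩ := hσ (algebraMap A L (.X i))
      (Finset.mem_insert_of_mem (Finset.mem_image_of_mem _ (Finset.mem_univ i)))
    exact ⟨1, a, by rw [ha, Algebra.smul_def, pow_one]⟩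
  obtain ⟨σi, hσi⟩ := (IsLocalization.map_units L σ).exists_right_inv
  obtain ⟨s, hs⟩ := (inferInstance : Algebra.FiniteType k R).out
  let xi (i : Fin n) : L := algebraMap F L (algebraMap A F (.X i))⁻¹
  have hxi (i) : algebraMap A L (.X i) * xi i = 1 := by
    rw [IsScalarTower.algebraMap_apply A F L, ← map_mul, mul_inv_cancel₀, map_one]
    simpa using MvPolynomial.X_ne_zero i
  -- The inverse of `σ` makes `σ` a unit, the generators of `R` give `R ⊆ A[β/h]`, and the `1/xᵢ`
  -- make the coordinates units. That `h` is a unit comes for free, so `r` may depend on `h`.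
  obtain ⟨h, hh, hsub⟩ := H.exists_scale_subset
    (insert σi (s.image (algebraMap R L) ∪ Finset.univ.image xi))
  set β' : L := (algebraMap A F h)⁻¹ • β with hβ'
  have hhF : algebraMap A F h ≠ 0 := by simpa using hh
  obtain ⟨hi, hhi, hhi1⟩ := H.exists_scale_mul_eq_one hh
  have H' := H.scale hh
  set G := g.comp (C h * X)
  -- the surjection onto the subalgebra generated by `β'`
  let e := MvPolynomial.finSuccEquiv k n
  let Φ : MvPolynomial (Fin (n + 1)) k →ₐ[k] L :=
    ((aeval (R := A) β').restrictScalars k).comp e.toAlgHom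
  have hΦ (p) : Φ p = aeval β' (e p) := rfl
  have hker (p) : Φ p = 0 ↔ e.symm G ∣ p := by
    rw [hΦ, H'.aeval_eq_zero_iff_dvd, ← map_dvd_iff e, e.apply_symm_apply]
  have hrange (x : L) : x ∈ Algebra.adjoin A {β'} ↔ ∃ p, Φ p = x := by
    rw [Algebra.adjoin_singleton_eq_range_aeval]
    exact ⟨fun ⟨p, hp⟩ ↦ ⟨e.symm p, by rw [hΦ, e.apply_symm_apply]; exact hp⟩,
      fun ⟨p, hp⟩ ↦ ⟨e p, hp⟩⟩
  set f := e.symm G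
  have hf0 : f ≠ 0 := fun h0 ↦ by
    have : G = 0 := by simpa [f] using h0
    simpa [this] using H'.coeff_zero
  let Ψ : (MvPolynomial (Fin (n + 1)) k ⧸ Ideal.span {f}) →ₐ[k] L :=
    Ideal.Quotient.liftₐ _ Φ fun a ha ↦ (hker a).mpr (Ideal.mem_span_singleton.mp ha)
  have hΨmk (p) : Ψ (Ideal.Quotient.mk _ p) = Φ p := rfl
  have hΨ : Function.Injective Ψ := by
    rw [injective_iff_map_eq_zero]
    intro q hq
    obtain ⟨p, rfl⟩ := Ideal.Quotient.mk_surjective q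
    rw [Ideal.Quotient.eq_zero_iff_mem, Ideal.mem_span_singleton, ← hker]
    exact hq
  have hΨr (x : L) : x ∈ Algebra.adjoin A {β'} ↔ x ∈ Ψ.range := by
    rw [hrange]
    exact ⟨fun ⟨p, hp⟩ ↦ ⟨Ideal.Quotient.mk _ p, hp⟩, fun ⟨q, hq⟩ ↦ by
      obtain ⟨p, rfl⟩ := Ideal.Quotient.mk_surjective q
      exact ⟨p, hq⟩⟩
  have hunit {q} {x : L} (hx : x ∈ Algebra.adjoin A {β'}) (hqx : Ψ q * x = 1) : IsUnit q := by
    obtain ⟨q', rfl⟩ := (hΨr x).mp hx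
    exact IsUnit.of_mul_eq_one q' (hΨ (by rw [map_mul, map_one]; exact hqx))
  have hRsub (a : R) : algebraMap R L a ∈ Ψ.range := by
    have : (⊤ : Subalgebra k R) ≤ Ψ.range.comap (IsScalarTower.toAlgHom k R L) := by
      rw [← hs]
      refine Algebra.adjoin_le fun a ha ↦ (hΨr _).mp (hsub ?_)
      simp only [Finset.coe_insert, Finset.coe_union, Finset.coe_image]
      exact Or.inr (Or.inl ⟨a, ha, rfl⟩)
    exact this (Algebra.mem_top (x := a))
  let φ : R →ₐ[k] MvPolynomial (Fin (n + 1)) k ⧸ Ideal.span {f} :=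
    (AlgEquiv.ofInjective Ψ hΨ).symm.toAlgHom.comp
      ((IsScalarTower.toAlgHom k R L).codRestrict Ψ.range hRsub)
  have hφ (a : R) : Ψ (φ a) = algebraMap R L a :=
    congrArg Subtype.val ((AlgEquiv.ofInjective Ψ hΨ).apply_symm_apply ⟨_, hRsub a⟩)
  -- the denominator
  obtain ⟨m, η, hη⟩ := algebraMap_mem_of_forall_X_mem hσX h
  let r : R := σ * η
  have hle : awaySubalgebra k L (σ : R) ≤ awaySubalgebra k L r := by
    rintro x ⟨l, a, ha⟩
    exact ⟨l, η ^ l * a, by simp only [r, map_mul, map_pow, ha]; ring⟩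
  have hhi_mem : algebraMap F L (algebraMap A F h)⁻¹ ∈ awaySubalgebra k L r := by
    refine ⟨1, σ * σ ^ m, ?_⟩
    have : algebraMap A L h * algebraMap F L (algebraMap A F h)⁻¹ = 1 := by
      rw [IsScalarTower.algebraMap_apply A F L, ← map_mul, mul_inv_cancel₀ hhF, map_one]
    simp only [r, map_mul, map_pow, hη]
    linear_combination (-algebraMap R L σ * algebraMap R L σ ^ m) * this
  have hβ'mem : β' ∈ awaySubalgebra k L r := by
    rw [hβ', Algebra.smul_def]
    exact mul_mem hhi_mem (hle hσβ)
  refine ⟨f, hf0, ?_, φ, r, ?_, ?_⟩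
  · intro i
    refine Fin.cases ?_ (fun i ↦ ?_) i
    -- The coordinate of index `0` is the class of `β/h`, a unit because its relation has constant
    -- term `1`.
    · obtain ⟨c, hc, hc1⟩ := H'.exists_mul_eq_one
      refine hunit hc ?_
      rw [hΨmk, hΦ, MvPolynomial.finSuccEquiv_X_zero, aeval_X, hc1]
    · refine hunit (x := xi i) (hsub ?_) ?_
      · simp only [Finset.coe_insert, Finset.coe_union, Finset.coe_image]
        exact Or.inr (Or.inr ⟨i, by simp, rfl⟩)
      · rw [hΨmk, hΦ, MvPolynomial.finSuccEquiv_X_succ, aeval_C, hxi]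
  · intro a b hab
    exact hRL (by rw [← hφ, hab, hφ])
  · let := φ.toRingHom.toAlgebra
    refine isLocalization_away_of_injective Ψ hΨ hRL hφ r ?_ fun q ↦ ?_
    · have hσi_mem : σi ∈ Algebra.adjoin A {β'} := hsub (by simp)
      refine hunit (x := σi * (σi ^ m * hi)) (mul_mem hσi_mem (mul_mem (pow_mem hσi_mem m) hhi)) ?_
      have h1 : Ψ (algebraMap R _ r) = algebraMap R L r := hφ r
      rw [h1, map_mul, hη]
      have h2 : algebraMap R L σ ^ m * σi ^ m = 1 := by rw [← mul_pow, hσi, one_pow]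
      calc _ = (algebraMap R L σ * σi) * (algebraMap R L σ ^ m * σi ^ m) *
            (algebraMap A L h * hi) := by
            ring
        _ = 1 := by rw [h2, hσi, hhi1]; simp
    · obtain ⟨p, rfl⟩ := Ideal.Quotient.mk_surjective q
      rw [hΨmk, hΦ, aeval_eq_sum_range]
      refine sum_mem fun j _ ↦ ?_
      rw [Algebra.smul_def]
      exact mul_mem (algebraMap_mem_of_forall_X_mem (fun i ↦ hle (hσX i)) _) (pow_mem hβ'mem j)

end Hypersurface

/-! ### Finite products of domains -/

section Product

theorem Algebra.FiniteType.pi_of_finite {k ι : Type*} [CommRing k] [Finite ι] (A : ι → Type*)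
    [∀ i, CommRing (A i)] [∀ i, Algebra k (A i)] [∀ i, Algebra.FiniteType k (A i)] :
    Algebra.FiniteType k (Π i, A i) := by
  classical
  have := Fintype.ofFinite ι
  choose s hs using fun i ↦ (inferInstance : Algebra.FiniteType k (A i)).out
  let t : Finset (Π i, A i) := Finset.univ.biUnion fun i ↦ (insert 1 (s i)).image (Pi.single i)
  refine ⟨t, Algebra.eq_top_iff.mpr fun x ↦ ?_⟩
  rw [← Finset.univ_sum_single x]
  refine Subalgebra.sum_mem (Algebra.adjoin k (t : Set (Π i, A i))) fun i _ ↦ ?_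
  have hmem (a : A i) (ha : a ∈ insert 1 (s i)) : Pi.single i a ∈
      Algebra.adjoin k (t : Set (Π i, A i)) :=
    Algebra.subset_adjoin (Finset.mem_biUnion.mpr
      ⟨i, Finset.mem_univ i, Finset.mem_image_of_mem _ ha⟩)
  have hx : x i ∈ Algebra.adjoin k (s i : Set (A i)) := hs i ▸ Algebra.mem_top
  generalize x i = y at hx
  induction hx using Algebra.adjoin_induction with
  | mem a ha => exact hmem a (Finset.mem_insert_of_mem ha)
  | algebraMap c =>
    have : Pi.single i (algebraMap k (A i) c) = c • (Pi.single i 1 : Π i, A i) := by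
      rw [← Pi.single_smul, Algebra.algebraMap_eq_smul_one]
    rw [this]
    exact Subalgebra.smul_mem _ (hmem 1 (Finset.mem_insert_self _ _)) c
  | add a b _ _ ha hb => rw [Pi.single_add]; exact add_mem ha hb
  | mul a b _ _ ha hb => rw [Pi.single_mul]; exact mul_mem ha hb

theorem nonZeroDivisors_pi {ι : Type*} (A : ι → Type*) [∀ i, CommRing (A i)] :
    nonZeroDivisors (Π i, A i) = Submonoid.pi .univ fun i ↦ nonZeroDivisors (A i) := by
  classical
  ext x
  simp only [Submonoid.mem_pi, mem_nonZeroDivisors_iff_right]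
  constructor
  · intro h i _ a ha
    have := h (Pi.single i a) (funext fun j ↦ by
      obtain rfl | hj := eq_or_ne j i
      · simpa using ha
      · simp [hj])
    simpa using congrFun this i
  · exact fun h a ha ↦ funext fun i ↦ h i trivial _ (congrFun ha i)

theorem isFractionRing_pi {ι : Type*} (A K : ι → Type*) [∀ i, CommRing (A i)]
    [∀ i, CommRing (K i)] [∀ i, Algebra (A i) (K i)] [∀ i, IsFractionRing (A i) (K i)] :
    IsFractionRing (Π i, A i) (Π i, K i) := by
  rw [IsFractionRing, nonZeroDivisors_pi]
  infer_instance

theorem exists_hypersurface_of_pi {k : Type u} [Field k] [PerfectField k] (n : ℕ)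
    (hn : 0 < n ∨ Infinite k) {ι : Type u} [Finite ι] (A : ι → Type u) [∀ i, CommRing (A i)]
    [∀ i, IsDomain (A i)] [∀ i, Algebra k (A i)] [∀ i, Algebra.FiniteType k (A i)]
    (hA : ∀ i, ringKrullDim (A i) = n) :
    ∃ f : MvPolynomial (Fin (n + 1)) k, f ≠ 0 ∧
      (∀ i, IsUnit (Ideal.Quotient.mk (Ideal.span {f}) (.X i))) ∧
      ∃ (φ : (Π i, A i) →ₐ[k] MvPolynomial (Fin (n + 1)) k ⧸ Ideal.span {f}) (r : Π i, A i),
        Function.Injective φ ∧ @IsLocalization.Away _ _ r _ _ φ.toRingHom.toAlgebra := by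
  let F := FractionRing (MvPolynomial (Fin n) k)
  let K (i : ι) := FractionRing (A i)
  choose ψ hψ using fun i ↦
    exists_algHom_rationalFunctions_isSeparable k (A i) n (hA i) (K i)
  let (i : ι) : Algebra F (K i) := (ψ i).toRingHom.toAlgebra
  have (i : ι) : FiniteDimensional F (K i) := (hψ i).1
  have (i : ι) : Algebra.IsSeparable F (K i) := (hψ i).2
  -- The only use of the alternative `n > 0` or `k` infinite.
  have : Infinite F := by
    have : Infinite (MvPolynomial (Fin n) k) := by
      obtain hn | hk := hn
      · have : Nonempty (Fin n) := ⟨⟨0, hn⟩⟩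
        infer_instance
      · exact Infinite.of_injective _ (MvPolynomial.C_injective (Fin n) k)
    exact Infinite.of_injective _ (IsFractionRing.injective (MvPolynomial (Fin n) k) F)
  let (i : ι) : Algebra (MvPolynomial (Fin n) k) (K i) :=
    ((algebraMap F (K i)).comp (algebraMap _ F)).toAlgebra
  have (i : ι) : IsScalarTower (MvPolynomial (Fin n) k) F (K i) := .of_algebraMap_eq' rfl
  have (i : ι) : IsScalarTower k (MvPolynomial (Fin n) k) (K i) :=
    .of_algebraMap_eq fun c ↦ ((ψ i).commutes c).symm
  have : IsFractionRing (Π i, A i) (Π i, K i) := isFractionRing_pi A K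
  have : Algebra.FiniteType k (Π i, A i) := .pi_of_finite A
  have : IsScalarTower k (Π i, A i) (Π i, K i) := .of_algebraMap_eq fun c ↦ funext fun i ↦
    IsScalarTower.algebraMap_apply k (A i) (K i) c
  have : IsScalarTower (MvPolynomial (Fin n) k) F (Π i, K i) :=
    .of_algebraMap_eq fun c ↦ funext fun i ↦
      IsScalarTower.algebraMap_apply (MvPolynomial (Fin n) k) F (K i) c
  have : IsScalarTower k (MvPolynomial (Fin n) k) (Π i, K i) :=
    .of_algebraMap_eq fun c ↦ funext fun i ↦
      IsScalarTower.algebraMap_apply k (MvPolynomial (Fin n) k) (K i) c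
  obtain ⟨β₀, g₀, h0, hsurj, hker⟩ := exists_generator_pi (F := F) K
  obtain ⟨β, g, H⟩ :=
    exists_isNormalizedGenerator (A := MvPolynomial (Fin n) k) h0 hsurj hker
  exact exists_hypersurface_of_isNormalizedGenerator n H

/-! ### Plane curves contained in the torus -/

section Torus

variable {k : Type u} [Field k] {f : MvPolynomial (Fin 2) k}
  (hf : ∀ i, IsUnit (Ideal.Quotient.mk (Ideal.span {f}) (.X i)))

/-- The coordinate ring of the torus maps to that of a plane curve on which both coordinates
are units. -/
noncomputable def TorusRing.toQuotient :
    TorusRing k →ₐ[k] MvPolynomial (Fin 2) k ⧸ Ideal.span {f} :=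
  IsLocalization.liftAlgHom (M := Submonoid.powers (.X 0 * .X 1 : MvPolynomial (Fin 2) k))
    (f := Ideal.Quotient.mkₐ k (Ideal.span {f})) (by
      rintro ⟨_, m, rfl⟩
      simpa using ((hf 0).mul (hf 1)).pow m)

theorem TorusRing.toQuotient_algebraMap (p : MvPolynomial (Fin 2) k) :
    TorusRing.toQuotient hf (algebraMap _ _ p) = Ideal.Quotient.mk _ p :=
  IsLocalization.lift_eq _ p

variable (f) in
/-- The map of coordinate rings of the inclusion into the plane of the part of the curve `f = 0`
in the torus. -/
noncomputable def toTorusQuotient : (MvPolynomial (Fin 2) k ⧸ Ideal.span {f}) →ₐ[k]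
    TorusRing k ⧸ Ideal.span {algebraMap (MvPolynomial (Fin 2) k) (TorusRing k) f} :=
  Ideal.Quotient.liftₐ _ ((Ideal.Quotient.mkₐ k _).comp
    (IsScalarTower.toAlgHom k (MvPolynomial (Fin 2) k) (TorusRing k))) (by
      intro a ha
      obtain ⟨b, rfl⟩ := Ideal.mem_span_singleton.mp ha
      rw [map_mul]
      exact mul_eq_zero_of_left (Ideal.Quotient.mk_singleton_self _) _)

/-- If both coordinates are units modulo `f`, the curve `f = 0` in the plane lies in the torus. -/
noncomputable def quotientEquivTorusQuotient : (MvPolynomial (Fin 2) k ⧸ Ideal.span {f}) ≃ₐ[k]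
    TorusRing k ⧸ Ideal.span {algebraMap (MvPolynomial (Fin 2) k) (TorusRing k) f} :=
  AlgEquiv.ofAlgHom
    (toTorusQuotient f)
    (Ideal.Quotient.liftₐ _ (TorusRing.toQuotient hf) (by
      intro a ha
      obtain ⟨b, rfl⟩ := Ideal.mem_span_singleton.mp ha
      rw [map_mul, TorusRing.toQuotient_algebraMap, Ideal.Quotient.mk_singleton_self, zero_mul]))
    (by
      apply Ideal.Quotient.algHom_ext
      apply IsLocalization.algHom_ext (Submonoid.powers (.X 0 * .X 1 : MvPolynomial (Fin 2) k))
      refine AlgHom.ext fun p ↦ ?_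
      exact congrArg (toTorusQuotient f) (TorusRing.toQuotient_algebraMap hf p))
    (by
      apply Ideal.Quotient.algHom_ext
      exact AlgHom.ext fun p ↦ TorusRing.toQuotient_algebraMap hf p)

end Torus

end Product

/-! ### Smooth schemes over an integral base are reduced -/

section Reduced

-- By flatness `B` embeds in its base change to the fraction field of `A`, and étale algebras over a
-- field are reduced.
open TensorProduct in
theorem Algebra.Etale.isReduced_of_isDomain (A B : Type*) [CommRing A] [IsDomain A] [CommRing B]
    [Algebra A B] [Algebra.Etale A B] : IsReduced B := by
  let K := FractionRing A
  have : IsReduced (K ⊗[A] B) := Algebra.FormallyUnramified.isReduced_of_field K (K ⊗[A] B)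
  have : Module.Flat A B := inferInstance
  refine isReduced_of_injective (Algebra.TensorProduct.includeRight : B →ₐ[A] K ⊗[A] B)
    (Algebra.TensorProduct.includeRight_injective (IsFractionRing.injective A K))

/-- Locally `X` is étale over an affine space over a domain. -/
theorem AlgebraicGeometry.IsReduced.of_smooth_of_isIntegral {X S : Scheme.{u}} (s : X ⟶ S)
    [IsIntegral S] [Smooth s] : IsReduced X := by
  refine @isReduced_of_isReduced_stalk X fun x ↦ ?_
  obtain ⟨U, hU, V, hV, hxV, e, hst⟩ := (Smooth.iff_forall_exists_isStandardSmooth s).mp ‹_› x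
  have : Nonempty U := ⟨⟨s x, e hxV⟩⟩
  obtain ⟨n, g, -, hg⟩ := hst.exists_etale_mvPolynomial
  algebraize [g]
  have := Algebra.Etale.isReduced_of_isDomain (MvPolynomial (Fin n) Γ(S, U)) Γ(X, V)
  have := hV.isLocalization_stalk ⟨x, hxV⟩
  let := TopCat.Presheaf.algebra_section_stalk X.presheaf (⟨x, hxV⟩ : V)
  change _root_.IsReduced (X.presheaf.stalk ((⟨x, hxV⟩ : V) : X))
  exact isReduced_localizationPreserves (hV.primeIdealOf ⟨x, hxV⟩).asIdeal.primeCompl _ ‹_›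

end Reduced

/-! ### Dimension of open subsets -/

section SchemeDimension

open TopologicalSpace Topology

/-- All members of a chain rising from `T` contain any chosen point of `T`, so the whole chain is
visible in a neighbourhood of that point. -/
theorem topologicalKrullDim_le_of_exists_open {X : Type*} [TopologicalSpace X] (d : WithBot ℕ∞)
    (H : ∀ x : X, ∃ W : Set X, IsOpen W ∧ x ∈ W ∧ topologicalKrullDim W ≤ d) :
    topologicalKrullDim X ≤ d := by
  rw [topologicalKrullDim, Order.krullDim_eq_iSup_coheight]
  refine iSup_le fun T ↦ ?_
  obtain ⟨x, hx⟩ := T.isIrreducible.nonempty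
  obtain ⟨W, hW, hxW, hd⟩ := H x
  have hemb : IsOpenEmbedding (Subtype.val : W → X) := hW.isOpenEmbedding_subtypeVal
  obtain ⟨T', hT'⟩ := (IrreducibleCloseds.orderIsoOfIsOpenEmbedding _ hemb).surjective
    ⟨T, ⟨⟨x, hxW⟩, hx⟩⟩
  have : IrreducibleCloseds.map _ hemb.continuous T' = T := congrArg Subtype.val hT'
  rw [← this, hemb.coheight_map]
  exact (Order.coheight_le_krullDim T').trans hd

theorem PrimeSpectrum.topologicalKrullDim_zeroLocus {R : Type*} [CommRing R] (I : Ideal R) :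
    topologicalKrullDim (PrimeSpectrum.zeroLocus (I : Set R)) = ringKrullDim (R ⧸ I) := by
  rw [← PrimeSpectrum.topologicalKrullDim_eq_ringKrullDim]
  have hemb := PrimeSpectrum.isClosedEmbedding_comap_of_surjective _ (Ideal.Quotient.mk I)
    Ideal.Quotient.mk_surjective
  have hr : Set.range (PrimeSpectrum.comap (Ideal.Quotient.mk I)) =
      PrimeSpectrum.zeroLocus (I : Set R) := by
    rw [range_comap_of_surjective _ _ Ideal.Quotient.mk_surjective, Ideal.mk_ker]
  rw [← hr]
  exact (IsHomeomorph.topologicalKrullDim_eq _ hemb.isEmbedding.toHomeomorph.isHomeomorph).symm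

theorem ringKrullDim_quotient_le_of_isLocalization_away (k : Type u) {B C : Type u} [Field k]
    [CommRing B] [Algebra k B] [Algebra.FiniteType k B] [CommRing C] [Algebra B C]
    (p : Ideal B) [p.IsPrime] {g : B} (hg : g ∉ p) [IsLocalization.Away g C] :
    ringKrullDim (B ⧸ p) ≤ ringKrullDim C := by
  let g' : B ⧸ p := Ideal.Quotient.mk p g
  have hg' : g' ≠ 0 := fun h ↦ hg (Ideal.Quotient.eq_zero_iff_mem.mp h)
  rw [← ringKrullDim_localization_away k (B := Localization.Away g') hg']
  have h : (Submonoid.powers g).map (Ideal.Quotient.mk p) = Submonoid.powers g' :=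
    Submonoid.map_powers _ _
  have : IsLocalization ((Submonoid.powers g).map (Ideal.Quotient.mk p))
      (Localization.Away g') := by rw [h]; infer_instance
  exact ringKrullDim_le_of_surjective _ (IsLocalization.map_surjective_of_surjective
    (Submonoid.powers g) C (Localization.Away g') (Ideal.Quotient.mk_surjective (I := p)))

theorem AlgebraicGeometry.IsAffineOpen.topologicalKrullDim_eq {X : Scheme.{u}} {U : X.Opens}
    (hU : IsAffineOpen U) : topologicalKrullDim U = ringKrullDim Γ(X, U) := by
  rw [← PrimeSpectrum.topologicalKrullDim_eq_ringKrullDim]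
  exact IsHomeomorph.topologicalKrullDim_eq _ (Scheme.homeoOfIso hU.isoSpec).isHomeomorph

/-- The ring homomorphism `k → Γ(X, U)` for a `k`-scheme `X` and an affine open `U`. -/
noncomputable def AlgebraicGeometry.IsAffineOpen.algebraMapOver {k : Type u} [Field k]
    {X : Scheme.{u}} {U : X.Opens} (hU : IsAffineOpen U) (s : X ⟶ Spec (.of k)) :
    CommRingCat.of k ⟶ Γ(X, U) :=
  Spec.preimage (hU.fromSpec ≫ s)

theorem AlgebraicGeometry.IsAffineOpen.finiteType_algebraMapOver {k : Type u} [Field k]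
    {X : Scheme.{u}} {U : X.Opens} (hU : IsAffineOpen U) (s : X ⟶ Spec (.of k))
    [LocallyOfFiniteType s] : (hU.algebraMapOver s).hom.FiniteType := by
  rw [← HasRingHomProperty.Spec_iff (P := @LocallyOfFiniteType), IsAffineOpen.algebraMapOver,
    Spec.map_preimage]
  infer_instance

/-- On an affine open `W` meeting `T`, the set `T ∩ W` embeds in the zero locus of a prime `P`. By
irreducibility `V` meets `W` in `T`, so some basic open `D(g) ⊆ V` has `g ∉ P`, and inverting `g`
does not lower the dimension of `Γ(X, W) ⧸ P`. -/
theorem topologicalKrullDim_eq_of_affineOpen_subset {k : Type u} [Field k] {X : Scheme.{u}}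
    (s : X ⟶ Spec (.of k)) [LocallyOfFiniteType s] {T : Set X} (hT : IsIrreducible T)
    {V : X.Opens} (hV : (V : Set X).Nonempty) (hVT : (V : Set X) ⊆ T) :
    topologicalKrullDim V = topologicalKrullDim T := by
  apply le_antisymm
  · exact (IsEmbedding.inclusion hVT).isInducing.topologicalKrullDim_le
  refine topologicalKrullDim_le_of_exists_open _ fun ⟨x, hxT⟩ ↦ ?_
  obtain ⟨_, ⟨W, hW, rfl⟩, hxW, -⟩ :=
    X.isBasis_affineOpens.exists_subset_of_mem_open (Set.mem_univ x) isOpen_univ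
  refine ⟨Subtype.val ⁻¹' (W : Set X), W.isOpen.preimage continuous_subtype_val, hxW, ?_⟩
  obtain ⟨y, hyT, hyV, hyW⟩ := hT.isPreirreducible V W V.isOpen W.isOpen
    (hV.mono fun v hv ↦ ⟨hVT hv, hv⟩) ⟨x, hxT, hxW⟩
  obtain ⟨g, hgV, hyg⟩ := hW.exists_basicOpen_le ⟨y, hyV⟩ hyW
  let ψ : (Subtype.val ⁻¹' (W : Set X) : Set T) → PrimeSpectrum Γ(X, W) :=
    fun z ↦ hW.primeIdealOf ⟨z.1.1, z.2⟩
  have hψ : IsInducing ψ := by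
    have h : IsInducing fun z : (Subtype.val ⁻¹' (W : Set X) : Set T) ↦ (⟨z.1.1, z.2⟩ : W) := by
      have h : IsInducing fun z : (Subtype.val ⁻¹' (W : Set X) : Set T) ↦ (z.1.1 : X) :=
        IsInducing.subtypeVal.comp IsInducing.subtypeVal
      exact ((IsInducing.subtypeVal (t := (W : Set X))).of_comp_iff
        (f := fun z : (Subtype.val ⁻¹' (W : Set X) : Set T) ↦
          (⟨z.1.1, z.2⟩ : (W : Set X)))).mp h
    exact (Scheme.homeoOfIso hW.isoSpec).isInducing.comp h
  have hirr : IsIrreducible (Set.range ψ) := by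
    have hirr' : IsIrreducible (Subtype.val ⁻¹' (W : Set X) : Set T) := by
      have : IrreducibleSpace T := isIrreducible_iff_irreducibleSpace.mp hT
      exact ⟨⟨⟨x, hxT⟩, hxW⟩, (PreirreducibleSpace.isPreirreducible_univ (X := T)).open_subset
        (W.isOpen.preimage continuous_subtype_val) (Set.subset_univ _)⟩
    have : IrreducibleSpace (Subtype.val ⁻¹' (W : Set X) : Set T) :=
      isIrreducible_iff_irreducibleSpace.mp hirr'
    rw [← Set.image_univ]
    exact (IrreducibleSpace.isIrreducible_univ _).image ψ hψ.continuous.continuousOn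
  let P := PrimeSpectrum.vanishingIdeal (Set.range ψ)
  have hP : P.IsPrime := PrimeSpectrum.isIrreducible_iff_vanishingIdeal_isPrime.mp hirr
  have hgP : g ∉ P := fun h ↦ by
    have h1 := (PrimeSpectrum.mem_vanishingIdeal _ _).mp h (ψ ⟨⟨y, hyT⟩, hyW⟩) ⟨_, rfl⟩
    have h2 : ψ ⟨⟨y, hyT⟩, hyW⟩ ∈ hW.fromSpec ⁻¹ᵁ X.basicOpen g := by
      change hW.fromSpec (hW.primeIdealOf ⟨y, hyW⟩) ∈ X.basicOpen g
      rwa [hW.fromSpec_primeIdealOf]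
    rw [hW.fromSpec_preimage_basicOpen] at h2
    exact h2 h1
  algebraize [(hW.algebraMapOver s).hom]
  have : Algebra.FiniteType k Γ(X, W) := hW.finiteType_algebraMapOver s
  have := hW.isLocalization_basicOpen g
  calc _ ≤ topologicalKrullDim (PrimeSpectrum.zeroLocus (P : Set Γ(X, W))) :=
        (hψ.codRestrict (fun z ↦
          PrimeSpectrum.subset_zeroLocus_vanishingIdeal (Set.range ψ)
            ⟨z, rfl⟩)).topologicalKrullDim_le
    _ = ringKrullDim (Γ(X, W) ⧸ P) := PrimeSpectrum.topologicalKrullDim_zeroLocus P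
    _ ≤ ringKrullDim Γ(X, X.basicOpen g) :=
        ringKrullDim_quotient_le_of_isLocalization_away k P hgP
    _ = topologicalKrullDim (X.basicOpen g) := (hW.basicOpen g).topologicalKrullDim_eq.symm
    _ ≤ topologicalKrullDim V := (IsEmbedding.inclusion hgV).isInducing.topologicalKrullDim_le

end SchemeDimension

/-! ### From rings to an open immersion -/

section OpenImmersion

open TopologicalSpace Topology Limits

open scoped Function in
/-- A reduced Noetherian scheme has a dense open subscheme that is a disjoint union of integral
affine schemes, one in each irreducible component and inside a given dense open. -/
theorem exists_affineOpens_irreducibleComponents {Z : Scheme.{u}}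
    [IsNoetherian Z] [IsReduced Z] (W : Z.Opens) (hW : Dense (W : Set Z)) :
    ∃ U : irreducibleComponents Z → Z.Opens, (∀ T, IsAffineOpen (U T)) ∧
      (∀ T, (U T : Set Z).Nonempty) ∧ (∀ T, (U T : Set Z) ⊆ T) ∧ (∀ T, U T ≤ W) ∧
      (∀ T, IsDomain Γ(Z, U T)) ∧ Pairwise (Disjoint on fun T ↦ (U T : Set Z)) ∧
      Dense (⋃ T, (U T : Set Z)) := by
  have hfin : (irreducibleComponents Z).Finite :=
    TopologicalSpace.NoetherianSpace.finite_irreducibleComponents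
  let O (T : irreducibleComponents Z) : Z.Opens :=
    ⟨(⋃₀ (irreducibleComponents Z \ {T.1}))ᶜ, by
      rw [Set.sUnion_eq_biUnion, isOpen_compl_iff]
      exact hfin.sdiff.isClosed_biUnion fun T hT ↦ isClosed_of_mem_irreducibleComponents T hT.1⟩
  have hOT (T : irreducibleComponents Z) : (O T : Set Z) ⊆ T := by
    intro x hx
    by_contra hxT
    refine hx ⟨irreducibleComponent x, ⟨irreducibleComponent_mem_irreducibleComponents x, ?_⟩,
      mem_irreducibleComponent⟩
    intro h
    exact hxT (Set.mem_singleton_iff.mp h ▸ mem_irreducibleComponent)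
  have hOne (T : irreducibleComponents Z) : (O T : Set Z).Nonempty := by
    have := closure_sUnion_irreducibleComponents_sdiff_singleton hfin T.1 T.2
    rw [← closure_nonempty_iff]
    exact this ▸ T.2.1.nonempty
  have hex (T : irreducibleComponents Z) : ∃ U : Z.Opens, IsAffineOpen U ∧
      (U : Set Z).Nonempty ∧ U ≤ O T ∧ U ≤ W := by
    obtain ⟨x, hxO, hxW⟩ := hW.inter_open_nonempty (O T) (O T).isOpen (hOne T)
    obtain ⟨_, ⟨U, hU, rfl⟩, hxU, hUs⟩ :=
      Z.isBasis_affineOpens.exists_subset_of_mem_open (a := x) (u := (O T : Set Z) ∩ W) ⟨hxO, hxW⟩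
      ((O T).isOpen.inter W.isOpen)
    exact ⟨U, hU, ⟨x, hxU⟩, fun y hy ↦ (hUs hy).1, fun y hy ↦ (hUs hy).2⟩
  choose U hU hne hUO hUW using hex
  have hUT (T) : (U T : Set Z) ⊆ T := fun x hx ↦ hOT T (hUO T hx)
  refine ⟨U, hU, hne, hUT, hUW, fun T ↦ ?_, fun T T' hTT' ↦ ?_, ?_⟩
  · have hirr : IsIrreducible (U T : Set Z) :=
      ⟨hne T, T.2.1.isPreirreducible.open_subset (U T).isOpen (hUT T)⟩
    have : IrreducibleSpace (U T) := isIrreducible_iff_irreducibleSpace.mp hirr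
    have : IsIntegral (U T) := isIntegral_of_irreducibleSpace_of_isReduced _
    have : Nonempty (U T) := (hne T).to_subtype
    exact (U T).topIso.symm.commRingCatIsoToRingEquiv.toMulEquiv.isDomain _
  · rw [Function.onFun, Set.disjoint_left]
    intro x hx hx'
    exact hUO T' hx' ⟨T.1, ⟨T.2, fun h ↦ hTT' (Subtype.ext h)⟩, hUT T hx⟩
  · rw [dense_iff_inter_open]
    rintro V hV ⟨x, hx⟩
    let T : irreducibleComponents Z :=
      ⟨irreducibleComponent x, irreducibleComponent_mem_irreducibleComponents x⟩
    obtain ⟨y, -, hyV, hyU⟩ := T.2.1.isPreirreducible V (U T) hV (U T).isOpen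
      ⟨x, mem_irreducibleComponent, hx⟩ ((hne T).mono fun y hy ↦ ⟨hUT T hy, hy⟩)
    exact ⟨y, hyV, Set.mem_iUnion.mpr ⟨T, hyU⟩⟩

theorem exists_isOpenImmersion_affineHypersurface {k : Type u} [Field k] [PerfectField k] (n : ℕ)
    (hn : 0 < n ∨ Infinite k) {Z : Scheme.{u}} (s : Z ⟶ Spec (.of k)) [LocallyOfFiniteType s]
    [QuasiCompact s] [IsReduced Z] (hZ : IsPureOfDim Z n) (W : Z.Opens)
    (hW : Dense (W : Set Z)) (hs : Smooth (W.ι ≫ s)) :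
    ∃ f : MvPolynomial (Fin (n + 1)) k, f ≠ 0 ∧
      (∀ i, IsUnit (Ideal.Quotient.mk (Ideal.span {f}) (.X i))) ∧
      Smooth (affineHypersurfaceToSpec f) ∧
      ∃ j : affineHypersurface f ⟶ Z, IsOpenImmersion j ∧ IsDominant j ∧
        j ≫ s = affineHypersurfaceToSpec f := by
  have : CompactSpace Z := QuasiCompact.compactSpace_of_compactSpace s
  have : IsNoetherian Z := { __ := LocallyOfFiniteType.isLocallyNoetherian s }
  obtain ⟨U, hU, hne, hUT, hUW, hdom, hdisj, hdense⟩ :=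
    exists_affineOpens_irreducibleComponents W hW
  have : Finite (irreducibleComponents Z) :=
    TopologicalSpace.NoetherianSpace.finite_irreducibleComponents
  let A (T : irreducibleComponents Z) : CommRingCat := Γ(Z, U T)
  let (T : irreducibleComponents Z) : Algebra k (A T) := ((hU T).algebraMapOver s).hom.toAlgebra
  have (T : irreducibleComponents Z) : Algebra.FiniteType k (A T) :=
    (hU T).finiteType_algebraMapOver s
  have hdim (T) : ringKrullDim (A T) = n := by
    rw [← (hU T).topologicalKrullDim_eq,
      topologicalKrullDim_eq_of_affineOpen_subset s T.2.1 (hne T) (hUT T), hZ T T.2]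
  obtain ⟨f, hf, hunit, φ, r, hφ, hloc⟩ := exists_hypersurface_of_pi n hn (fun T ↦ A T) hdim
  let α (T) : Spec (A T) ⟶ Z := (hU T).fromSpec
  have hrange (T) : Set.range (α T) = U T := (hU T).range_fromSpec
  have hα : IsOpenImmersion (Sigma.desc α) := by
    refine isOpenImmersion_sigmaDesc _ _ fun T T' h ↦ ?_
    rw [Function.onFun, hrange, hrange]
    exact hdisj h
  -- There are finitely many components, so the disjoint union of the spectra is the spectrum of the
  -- product.
  let j₀ : Spec (.of (Π T, A T)) ⟶ Z := inv (sigmaSpec A) ≫ Sigma.desc α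
  have hj₀ (T) : Spec.map (CommRingCat.ofHom (Pi.evalRingHom (fun T ↦ A T) T)) ≫ j₀ = α T := by
    rw [← ι_sigmaSpec, Category.assoc, IsIso.hom_inv_id_assoc, Sigma.ι_desc]
  have hj₀s : j₀ ≫ s = Spec.map (CommRingCat.ofHom (algebraMap k (Π T, A T))) := by
    rw [← cancel_epi (sigmaSpec A)]
    refine Sigma.hom_ext _ _ fun T ↦ ?_
    rw [ι_sigmaSpec_assoc, ι_sigmaSpec_assoc, ← Category.assoc, hj₀, ← Spec.map_comp]
    exact (Spec.map_preimage _).symm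
  have hj₀dom : IsDominant j₀ := by
    refine ⟨hdense.mono ?_⟩
    rintro x hx
    obtain ⟨T, hx⟩ := Set.mem_iUnion.mp hx
    rw [← hrange, ← hj₀] at hx
    obtain ⟨y, rfl⟩ := hx
    exact ⟨_, (Scheme.Hom.comp_apply _ _ _).symm⟩
  have hj₀W : Set.range j₀ ⊆ W := by
    rintro _ ⟨x, rfl⟩
    obtain ⟨x, rfl⟩ := (sigmaSpec A).surjective x
    obtain ⟨T, y, rfl⟩ : ∃ (T : irreducibleComponents Z) (y : Spec (A T)),
        Sigma.ι (fun T ↦ Spec (A T)) T y = x :=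
      (sigmaOpenCover fun T ↦ Spec (A T)).exists_eq x
    rw [← Scheme.Hom.comp_apply, ← Scheme.Hom.comp_apply, ι_sigmaSpec_assoc, hj₀]
    exact hUW T ((hrange T).subset ⟨y, rfl⟩)
  let i : affineHypersurface f ⟶ Spec (.of (Π T, A T)) := Spec.map (CommRingCat.ofHom φ.toRingHom)
  have hi : IsOpenImmersion i := by
    let := φ.toRingHom.toAlgebra
    exact IsOpenImmersion.of_isLocalization r
  have hidom : IsDominant i := by
    refine ⟨(PrimeSpectrum.denseRange_comap_iff_ker_le_nilRadical φ.toRingHom).mpr ?_⟩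
    rw [(RingHom.injective_iff_ker_eq_bot φ.toRingHom).mp hφ]
    exact bot_le
  have hjs : (i ≫ j₀) ≫ s = affineHypersurfaceToSpec f := by
    rw [Category.assoc, hj₀s]
    refine (Spec.map_comp _ _).symm.trans (congrArg Spec.map ?_)
    exact congrArg CommRingCat.ofHom φ.comp_algebraMap
  refine ⟨f, hf, hunit, ?_, i ≫ j₀, inferInstance, inferInstance, hjs⟩
  -- The hypersurface is smooth because it is an open subscheme of `W`.
  have hjW : Set.range (i ≫ j₀) ⊆ Set.range W.ι := by
    rw [Scheme.Opens.range_ι]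
    rintro _ ⟨x, rfl⟩
    rw [Scheme.Hom.comp_apply]
    exact hj₀W ⟨_, rfl⟩
  rw [← hjs, ← IsOpenImmersion.lift_fac W.ι (i ≫ j₀) hjW, Category.assoc]
  have : IsOpenImmersion (IsOpenImmersion.lift W.ι (i ≫ j₀) hjW) := inferInstance
  infer_instance

end OpenImmersion

/-! ### Quasi-compactness of projective schemes, and the main theorem -/

section ProjectiveSpace

attribute [local instance] MvPolynomial.gradedAlgebra

theorem quasiCompact_projSpaceToSpec (k : Type u) [Field k] (m : ℕ) :
    QuasiCompact (projSpaceToSpec k m) := by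
  have : IsScalarTower k (MvPolynomial.homogeneousSubmodule (Fin (m + 1)) k 0)
      (MvPolynomial (Fin (m + 1)) k) :=
    ⟨fun a b c ↦ smul_mul_assoc a (b : MvPolynomial (Fin (m + 1)) k) c⟩
  have : Algebra.FiniteType (MvPolynomial.homogeneousSubmodule (Fin (m + 1)) k 0)
      (MvPolynomial (Fin (m + 1)) k) := .of_restrictScalars_finiteType k _ _
  have : QuasiCompact (Proj.toSpecZero (MvPolynomial.homogeneousSubmodule (Fin (m + 1)) k)) :=
    inferInstance
  exact MorphismProperty.comp_mem @QuasiCompact _ _ this inferInstance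

end ProjectiveSpace

theorem IsProjectiveOver.quasiCompact {k : Type u} [Field k] {X : Scheme.{u}}
    {s : X ⟶ Spec (.of k)} (h : IsProjectiveOver s) : QuasiCompact s := by
  obtain ⟨m, i, hi, rfl⟩ := h
  have := quasiCompact_projSpaceToSpec k m
  infer_instance

/-- The isomorphism between `f = 0` in the torus and in the plane, if both coordinates are units
modulo `f`. -/
noncomputable def torusCurveIso {k : Type u} [Field k] {f : MvPolynomial (Fin 2) k}
    (hf : ∀ i, IsUnit (Ideal.Quotient.mk (Ideal.span {f}) (.X i))) :
    torusCurve (algebraMap (MvPolynomial (Fin 2) k) (TorusRing k) f) ≅ affineHypersurface f :=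
  Scheme.Spec.mapIso (quotientEquivTorusQuotient hf).toRingEquiv.toCommRingCatIso.op

theorem torusCurveIso_hom_comp {k : Type u} [Field k] {f : MvPolynomial (Fin 2) k}
    (hf : ∀ i, IsUnit (Ideal.Quotient.mk (Ideal.span {f}) (.X i))) :
    (torusCurveIso hf).hom ≫ affineHypersurfaceToSpec f =
      torusCurveToSpec (algebraMap (MvPolynomial (Fin 2) k) (TorusRing k) f) := by
  refine (Spec.map_comp _ _).symm.trans (congrArg Spec.map ?_)
  exact congrArg CommRingCat.ofHom (quotientEquivTorusQuotient hf).toAlgHom.comp_algebraMap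

theorem theoremA2 (k : Type u) [Field k] [PerfectField k] :
    -- a smooth affine hypersurface birational to a given variety
    (∀ (n : ℕ) (Z : Scheme.{u}) (s : Z ⟶ Spec (.of k)),
      LocallyOfFiniteType s → QuasiCompact s → IsSeparated s → GeometricallyReduced s →
      IsPureOfDim Z n → (0 < n ∨ Infinite k) →
      ∃ f : MvPolynomial (Fin (n + 1)) k, f ≠ 0 ∧
        Smooth (affineHypersurfaceToSpec f) ∧
        Scheme.BirationalOver s (affineHypersurfaceToSpec f)) ∧
    (∀ (C : Scheme.{u}) (s : C ⟶ Spec (.of k)), IsSmoothProjectiveCurve s →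
      -- a dense affine open isomorphic to a smooth plane curve
      (∃ (U : C.Opens) (f : MvPolynomial (Fin 2) k),
        IsAffineOpen U ∧ Dense (U : Set C) ∧ f ≠ 0 ∧
        Smooth (affineHypersurfaceToSpec f) ∧
        ∃ e : U.toScheme ≅ affineHypersurface f,
          e.hom ≫ affineHypersurfaceToSpec f = U.ι ≫ s) ∧
      -- the smooth completion of a smooth curve in the torus, which it contains as a dense open
      (∃ g : TorusRing k, g ≠ 0 ∧
        Smooth (torusCurveToSpec g) ∧
        IsSmoothCompletion s (torusCurveToSpec g) ∧
        ∃ j : torusCurve g ⟶ C, IsOpenImmersion j ∧ IsDominant j ∧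
          j ≫ s = torusCurveToSpec g)) := by
  refine ⟨fun n Z s _ _ _ _ hZ hn ↦ ?_, fun C s hC ↦ ?_⟩
  · have : IsReduced Z := GeometricallyReduced.isReduced_of_flat_of_isLocallyNoetherian s
    have : LocallyOfFinitePresentation s := inferInstance
    have hsm : Smooth (s.smoothLocus.ι ≫ s) := by
      rw [← Scheme.Hom.smoothLocus_eq_top_iff, ← Scheme.Hom.preimage_smoothLocus_eq]
      simp
    -- Over a perfect field the smooth locus of a reduced scheme locally of finite type is dense, so
    -- it can serve as `W`.
    obtain ⟨f, hf, -, hfs, j, _, _, hj⟩ := exists_isOpenImmersion_affineHypersurface n hn s hZ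
      s.smoothLocus s.dense_smoothLocus_of_perfectField hsm
    exact ⟨f, hf, hfs, (Scheme.Hom.birationalOver j s _ hj).symm⟩
  · have := hC.smooth
    have := hC.projective.quasiCompact
    have : IsReduced C := .of_smooth_of_isIntegral s
    -- All of `C` is smooth, so `W = ⊤`; since `n = 1 > 0`, finite fields are allowed. The same `f`
    -- serves for the plane and for the torus.
    obtain ⟨f, hf, hunit, hfs, j, _, _, hj⟩ := exists_isOpenImmersion_affineHypersurface 1
      (.inl one_pos) s hC.pure ⊤ dense_univ inferInstance
    refine ⟨⟨j.opensRange, f, ?_, j.denseRange, hf, hfs, j.isoOpensRange.symm, ?_⟩, ?_⟩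
    · have : IsAffine (affineHypersurface f) := inferInstanceAs (IsAffine (Spec _))
      exact isAffineOpen_opensRange j
    · rw [Iso.symm_hom, Iso.inv_comp_eq, ← hj, ← Category.assoc]
      simp
    · refine ⟨algebraMap _ _ f, ?_, ?_⟩
      · have : Submonoid.powers (.X 0 * .X 1 : MvPolynomial (Fin 2) k) ≤ nonZeroDivisors _ :=
          powers_le_nonZeroDivisors_of_noZeroDivisors
            (mul_ne_zero (MvPolynomial.X_ne_zero 0) (MvPolynomial.X_ne_zero 1))
        exact (map_ne_zero_iff _ (IsLocalization.injective (TorusRing k) this)).mpr hf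
      · have hjs : ((torusCurveIso hunit).hom ≫ j) ≫ s = torusCurveToSpec (algebraMap _ _ f) := by
          rw [Category.assoc, hj, torusCurveIso_hom_comp]
        refine ⟨?_, ⟨hC, ?_⟩, (torusCurveIso hunit).hom ≫ j, inferInstance, inferInstance, hjs⟩
        · rw [← torusCurveIso_hom_comp hunit]
          infer_instance
        · exact Scheme.Hom.birationalOver _ s _ hjs
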